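/- Setting. The state space is a set $\Omega\subseteq\mathbb Z$; the signal space $S\subseteq\mathbb R$ is countable or an interval. A signal structure is a family $f(\cdot|\omega)$, $\omega\in\Omega$, of probability mass functions on $S$ (if $S$ is countable) or probability densities on $S$ (if $S$ is a nondegenerate interval), with $f(s|\omega)>0$ for all $s,\omega$ and $f(s|\cdot)$ bounded for every $s$. There is a set $\mathcal A$ of at least two actions. A utility is a function $u:\mathcal A\times\Omega\to\mathbb R$ with $u(a,\cdot)$ bounded for each $a$, such that every countable choice set $A\subseteq\mathcal A$ with $|A|>1$ contains an optimal action under every belief. It has single-crossing differences (SCD) if for all $a,a'$ the function $h=u(a,\cdot)-u(a',\cdot)$ satisfies either [$h(\omega)>0\Rightarrow h(\omega')\ge 0$ for all $\omega<\omega'$] or [$h(\omega)<0\Rightarrow h(\omega')\le 0$ for all $\omega<\omega'$]. The structure satisfies MLRP if $\frac{f(s'|\omega')}{f(s'|\omega)}\ge\frac{f(s|\omega')}{f(s|\omega)}$ whenever $\omega'>\omega$ and $s'>s$. It has directionally unbounded beliefs (DUB) if for every $\omega$ there are $C>0$ and sequences of signals $(\overline s_i)$, $(\underline s_i)$ such that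 for all $\omega'<\omega$, $\lim_i \frac{f(\overline s_i|\omega')}{f(\overline s_i|\omega)}=0$ and $\frac{f(\overline s_i|\omega')}{f(\overline s_i|\omega)}<C$ for all $i$, and for all $\omega'>\omega$, $\lim_i \frac{f(\underline s_i|\omega')}{f(\underline s_i|\omega)}=0$ and $\frac{f(\underline s_i|\omega')}{f(\underline s_i|\omega)}<C$ for all $i$. If $S$ is a nondegenerate interval, signals in a Lebesgue-null set are disregarded in MLRP, and the requirements of DUB have to hold for sequences of sets of signals of positive Lebesgue measure (for every selection of signals from these sets). Game. A state $\omega$ is drawn from a prior $\mu_0$ on $\Omega$. Agents $n=1,2,\dots$ move in sequence; agent $n$ observes the actions of her predecessors and a private signal drawn independently from $f(\cdot|\omega)$, and chooses, possibly at random, an action from a choice set $A\subseteq\mathcal A$ to maximize the expectation of $u$. Consider the Bayes Nash equilibria. The public belief of agent $n$ is the conditional distribution of the state given the actions of her predecessors. A belief $\mu$ has adequate knowledge if some $a\in A$ is optimal in $A$ at every state $\omega$ in the support of $\mu$. Learning is inadequate at the prior $\mu_0$ for the choice set $A$ if in every equilibrium, with positive probability, the limit of the public beliefs does not have adequate knowledge.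 Proposition. If the signal structure satisfies MLRP but fails DUB, then there are a utility $u$ with SCD, two distinct actions $a,b\in\mathcal A$ and a state $\omega^*\in\Omega$ such that $u(a,\omega)>u(b,\omega)$ for all $\omega<\omega^*$, $u(b,\omega)>u(a,\omega)$ for all $\omega\ge\omega^*$, and for every prior $\mu_0$ with $\mu_0(\omega)>0$ for all $\omega\in\Omega$, learning is inadequate at $\mu_0$ for the choice set $\{a,b\}$. -/

import Mathlib

open MeasureTheory ProbabilityTheory Filter Topology
open scoped ENNReal

noncomputable section

namespace SequentialLearning

/-! ### States, signals, information -/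

open Classical in
/-- The reference measure on the signal space: counting measure when the signal space is countable
(so densities are probability mass functions), and Lebesgue measure otherwise. -/
def refMeasure (S : Set ℝ) : Measure S :=
  if S.Countable then Measure.count else Measure.comap (Subtype.val : S → ℝ) volume

/-- A signal structure: for each state `ω` a probability mass function, respectively a probability
density function, `s ↦ f s ω` on the signal space. No signal excludes a state, and
`f s` is bounded in the state for every signal `s`. -/
structure SignalStructure (Ω : Set ℤ) (S : Set ℝ) where
  /-- The density `f s ω` of the signal `s` in the state `ω`. -/
  f : S → Ω → ℝ
  measurable_f : ∀ ω, Measurable fun s => f s ω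
  pos : ∀ s ω, 0 < f s ω
  lintegral_eq_one : ∀ ω, ∫⁻ s, ENNReal.ofReal (f s ω) ∂(refMeasure S) = 1
  bounded : ∀ s, BddAbove (Set.range (f s))

variable {Ω : Set ℤ} {S : Set ℝ}

/-- The law of a private signal in state `ω`. -/
def SignalStructure.signalLaw (I : SignalStructure Ω S) (ω : Ω) : Measure S :=
  (refMeasure S).withDensity fun s => ENNReal.ofReal (I.f s ω)

instance (I : SignalStructure Ω S) (ω : Ω) : IsProbabilityMeasure (I.signalLaw ω) :=
  ⟨by rw [SignalStructure.signalLaw, withDensity_apply _ MeasurableSet.univ,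
        Measure.restrict_univ, I.lintegral_eq_one]⟩

/-- Monotone likelihood ratio property. Signals in a null set are disregarded; when the signal
space is countable, the only null set is the empty one. -/
def SignalStructure.MLRP (I : SignalStructure Ω S) : Prop :=
  ∃ T : Set S, (∀ᵐ s ∂(refMeasure S), s ∈ T) ∧
    ∀ ω ω' : Ω, ω < ω' → ∀ s ∈ T, ∀ s' ∈ T, s < s' →
      I.f s ω' / I.f s ω ≤ I.f s' ω' / I.f s' ω

/-- Directionally unbounded beliefs. The requirements on signals are to hold for sets of signals of
positive measure: there are sequences `B`, `B'` of such sets so that every choice of signals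
`s i ∈ B i`, respectively `s i ∈ B' i`, has the required likelihood-ratio properties. When the
signal space is countable, every single signal has positive measure and this amounts to
the existence of two sequences of signals. -/
def SignalStructure.DUB (I : SignalStructure Ω S) : Prop :=
  ∀ ω : Ω, ∃ C : ℝ, 0 < C ∧ ∃ B B' : ℕ → Set S,
    (∀ i, MeasurableSet (B i) ∧ 0 < refMeasure S (B i)) ∧
    (∀ i, MeasurableSet (B' i) ∧ 0 < refMeasure S (B' i)) ∧
    (∀ s : ℕ → S, (∀ i, s i ∈ B i) → ∀ ω' : Ω, ω' < ω →
      Tendsto (fun i => I.f (s i) ω' / I.f (s i) ω) atTop (𝓝 0) ∧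
      ∀ i, I.f (s i) ω' / I.f (s i) ω < C) ∧
    (∀ s : ℕ → S, (∀ i, s i ∈ B' i) → ∀ ω' : Ω, ω < ω' →
      Tendsto (fun i => I.f (s i) ω' / I.f (s i) ω) atTop (𝓝 0) ∧
      ∀ i, I.f (s i) ω' / I.f (s i) ω < C)

/-! ### Preferences -/

/-- A function of the state that switches strict sign at most once. -/
def SingleCrossing (h : Ω → ℝ) : Prop :=
  (∀ x x' : Ω, x < x' → 0 < h x → 0 ≤ h x') ∨ (∀ x x' : Ω, x < x' → h x < 0 → h x' ≤ 0)

variable {𝒜 : Type*}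

/-- Single-crossing differences. -/
def SCD (u : 𝒜 → Ω → ℝ) : Prop :=
  ∀ a a' : 𝒜, SingleCrossing fun ω => u a ω - u a' ω

/-- The expected utility of the action `a` under the belief `μ`. -/
def expectedUtility (u : 𝒜 → Ω → ℝ) (μ : PMF Ω) (a : 𝒜) : ℝ :=
  ∑' ω, (μ ω).toReal * u a ω

/-- The choice correspondence: the actions in the choice set `A` that are optimal under `μ`. -/
def choice (u : 𝒜 → Ω → ℝ) (A : Set 𝒜) (μ : PMF Ω) : Set 𝒜 :=
  {a | a ∈ A ∧ ∀ b ∈ A, expectedUtility u μ b ≤ expectedUtility u μ a}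

/-- Standing assumptions on a utility function: every `u a` is bounded in the state, and
in every (countable, nontrivial) choice set there is an optimal action under every belief. -/
structure Admissible (u : 𝒜 → Ω → ℝ) : Prop where
  bounded : ∀ a, ∃ C, ∀ ω, |u a ω| ≤ C
  choice_nonempty : ∀ A : Set 𝒜, A.Countable → A.Nontrivial → ∀ μ, (choice u A μ).Nonempty

/-- Adequate knowledge at `μ`: some action is optimal in every state in the support of `μ`. -/
def AdequateKnowledge (u : 𝒜 → Ω → ℝ) (A : Set 𝒜) (μ : PMF Ω) : Prop :=
  (⋂ ω ∈ μ.support, choice u A (PMF.pure ω)).Nonempty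

/-! ### The game -/

variable [MeasurableSpace 𝒜] {A : Set 𝒜}

/-- A profile of mixed strategies. An agent moving after the history `h` (the list of the
predecessors' actions, first action first) is agent number `h.length`, counted from zero, and
`act h` is the measurable map that assigns to her private signal a distribution of her action. -/
structure StrategyProfile (S : Set ℝ) (A : Set 𝒜) where
  /-- The mixed action after a history, as a function of the private signal. -/
  act : List A → Kernel S A
  isMarkov : ∀ h, IsMarkovKernel (act h)

/-- The law of the action taken after the history `h` in state `ω`: the private signal is a fresh
draw from the signal distribution in state `ω`. -/
def actionLaw (I : SignalStructure Ω S) (σ : StrategyProfile S A) (ω : Ω) (h : List A) :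
    Measure A :=
  (I.signalLaw ω).bind (σ.act h)

instance (I : SignalStructure Ω S) (σ : StrategyProfile S A) (ω : Ω) (h : List A) :
    IsProbabilityMeasure (actionLaw I σ ω h) := by
  have := σ.isMarkov h
  unfold actionLaw
  infer_instance

variable [DiscreteMeasurableSpace 𝒜] [Countable A]

/-- The transition kernel from the first `n + 1` actions to the next one, in state `ω`. -/
def stepKernel (I : SignalStructure Ω S) (σ : StrategyProfile S A) (ω : Ω) (n : ℕ) :
    Kernel (Finset.Iic n → A) A :=
  Kernel.ofFunOfCountable fun x =>
    actionLaw I σ ω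
      (List.ofFn fun i : Fin (n + 1) => x ⟨i, Finset.mem_Iic.2 (Nat.lt_succ_iff.1 i.isLt)⟩)

instance (I : SignalStructure Ω S) (σ : StrategyProfile S A) (ω : Ω) (n : ℕ) :
    IsMarkovKernel (stepKernel I σ ω n) :=
  ⟨fun _ => inferInstanceAs (IsProbabilityMeasure (actionLaw I σ ω _))⟩

/-- The law of the infinite sequence of actions, as a kernel from the state. -/
def pathKernel (I : SignalStructure Ω S) (σ : StrategyProfile S A) : Kernel Ω (ℕ → A) :=
  Kernel.ofFunOfCountable fun ω =>
    Kernel.trajMeasure (X := fun _ => A) (actionLaw I σ ω []) (stepKernel I σ ω)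

instance (I : SignalStructure Ω S) (σ : StrategyProfile S A) : IsMarkovKernel (pathKernel I σ) :=
  ⟨fun ω => inferInstanceAs (IsProbabilityMeasure
    (Kernel.trajMeasure (X := fun _ => A) (actionLaw I σ ω []) (stepKernel I σ ω)))⟩

/-- The joint law of the state and the infinite sequence of actions, under the prior `μ₀`. -/
def outcomeLaw (μ₀ : PMF Ω) (I : SignalStructure Ω S) (σ : StrategyProfile S A) :
    Measure (Ω × (ℕ → A)) :=
  μ₀.toMeasure ⊗ₘ pathKernel I σ

instance (μ₀ : PMF Ω) (I : SignalStructure Ω S) (σ : StrategyProfile S A) :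
    IsProbabilityMeasure (outcomeLaw μ₀ I σ) := by
  unfold outcomeLaw
  infer_instance

/-- The ex ante expected utility of agent number `n`. (For a finite choice set the integrand is
integrable as soon as every `u a` is bounded.) -/
def payoff (u : 𝒜 → Ω → ℝ) (μ₀ : PMF Ω) (I : SignalStructure Ω S) (σ : StrategyProfile S A)
    (n : ℕ) : ℝ :=
  ∫ x, u (x.2 n) x.1 ∂(outcomeLaw μ₀ I σ)

/-- Bayes Nash equilibrium: no agent `n` gains by a unilateral change of her strategy. -/
def IsEquilibrium (u : 𝒜 → Ω → ℝ) (μ₀ : PMF Ω) (I : SignalStructure Ω S)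
    (σ : StrategyProfile S A) : Prop :=
  ∀ (n : ℕ) (τ : StrategyProfile S A), (∀ h, h.length ≠ n → τ.act h = σ.act h) →
    payoff u μ₀ I τ n ≤ payoff u μ₀ I σ n

/-- The public belief given the first `n` actions of the sequence `p`: by Bayes' rule, the
conditional probability of each state given that these actions were taken. -/
def publicBelief (μ₀ : PMF Ω) (I : SignalStructure Ω S) (σ : StrategyProfile S A)
    (p : ℕ → A) (n : ℕ) (ω : Ω) : ℝ≥0∞ :=
  (outcomeLaw μ₀ I σ)[{x | x.1 = ω} | {x | ∀ i < n, x.2 i = p i}]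

/-- The event that the public beliefs converge to a belief without adequate knowledge. -/
def inadequateLimit (u : 𝒜 → Ω → ℝ) (μ₀ : PMF Ω) (I : SignalStructure Ω S)
    (σ : StrategyProfile S A) : Set (Ω × (ℕ → A)) :=
  {x | ∃ μ : PMF Ω,
    (∀ ω, Tendsto (fun n => publicBelief μ₀ I σ x.2 n ω) atTop (𝓝 (μ ω))) ∧
    ¬ AdequateKnowledge u A μ}

/-- Inadequate learning at the prior `μ₀` for the choice set `A`: in every equilibrium, with
positive probability the limit public belief does not have adequate knowledge. -/
def InadequateLearning (u : 𝒜 → Ω → ℝ) (I : SignalStructure Ω S) (μ₀ : PMF Ω)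
    (A : Set 𝒜) [Countable A] : Prop :=
  ∀ σ : StrategyProfile S A, IsEquilibrium u μ₀ I σ →
    0 < outcomeLaw μ₀ I σ (inadequateLimit u μ₀ I σ)

end SequentialLearning

end

noncomputable section

namespace SequentialLearning

section

variable {Ω : Set ℤ} {S : Set ℝ} {𝒜 : Type*} {A : Set 𝒜}

/-! ### Cylinders of action paths -/

/-! If every likelihood ratio `f(·|y)/f(·|x)`, `y ≠ x`, had essential infimum zero, MLRP would let
all ratios on one side of `x` vanish together, which is DUB. So failure of DUB yields states `x₀ ≠
x₁` and `c > 0` with `c f(s|x₁) ≤ f(s|x₀)` for almost all `s` (`exists_bounded_ratio_of_not_DUB`).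
Put the threshold at the larger of the two: one action, `α`, is right at `x₀` and on a set `L` of
states, the other, `β`, at `x₁` and on the complement of `L`, and every mistake costs one unit.

Suppose that in some equilibrium the limit belief almost surely has adequate knowledge. Where it
charges `x₀` it cannot charge the complement of `L`, so by martingale convergence some history makes
`x₀` likelier than that complement (`exists_cyl_lt`). In equilibrium `β` is chosen after a history
only if `L` is then no likelier than its complement. Summed over the time of the first `β` after
that history, this leaves too little mass for a `β` to occur almost surely in state `x₀`, so there
is a path of positive probability in `x₀` that ends in `α` forever (`exists_path_pos`).

Along this path the probabilities of leaving it are summable in state `x₀`. In `x₁` they are at most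
`c⁻¹` times as large, so the path has positive probability there too (`pathKernel_singleton_pos`).
The limit belief on the path then charges both `x₀` and `x₁`, a contradiction. No cutoff description
of equilibrium strategies is needed. -/

/-- The paths that agree with `p` in the first `n` actions. -/
def cyl (p : ℕ → A) (n : ℕ) : Set (ℕ → A) := {q | ∀ i < n, q i = p i}

/-- The list of the first `n` actions of a path. -/
def hist (p : ℕ → A) (n : ℕ) : List A := List.ofFn fun i : Fin n => p i

lemma length_hist (p : ℕ → A) (n : ℕ) : (hist p n).length = n := by simp [hist]

lemma hist_eq_iff (p q : ℕ → A) (n : ℕ) : hist q n = hist p n ↔ q ∈ cyl p n := by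
  simp only [hist, List.ofFn_inj, funext_iff, cyl, Set.mem_ofPred_eq]
  exact ⟨fun h i hi => h ⟨i, hi⟩, fun h i => h i i.2⟩

lemma cyl_zero (p : ℕ → A) : cyl p 0 = Set.univ := by simp [cyl]

lemma mem_cyl_self (p : ℕ → A) (n : ℕ) : p ∈ cyl p n := fun _ _ => rfl

lemma cyl_succ (p : ℕ → A) (n : ℕ) : cyl p (n + 1) = cyl p n ∩ {q | q n = p n} := by
  ext q
  refine ⟨fun h => ⟨fun i hi => h i (by omega), h n (by omega)⟩, fun h i hi => ?_⟩
  obtain hi | rfl := Nat.lt_succ_iff_lt_or_eq.1 hi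
  exacts [h.1 i hi, h.2]

lemma cyl_antitone (p : ℕ → A) : Antitone (cyl p) :=
  fun _ _ h _ hq i hi => hq i (hi.trans_le h)

lemma cyl_congr {p q : ℕ → A} {n : ℕ} (h : q ∈ cyl p n) : cyl q n = cyl p n := by
  ext r
  exact forall₂_congr fun i hi => by rw [h i hi]

lemma iInter_cyl (p : ℕ → A) : ⋂ n, cyl p n = {p} := by
  ext q
  simp only [Set.mem_iInter, cyl, Set.mem_ofPred_eq, Set.mem_singleton_iff, funext_iff]
  exact ⟨fun h i => h (i + 1) i (by omega), fun h n i _ => h i⟩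

variable [MeasurableSpace 𝒜]

/-- Densities are strictly positive, so all signal laws have the same null sets as the reference
measure. -/
lemma signalLaw_absolutelyContinuous (I : SignalStructure Ω S) (x₀ x₁ : Ω) :
    I.signalLaw x₀ ≪ I.signalLaw x₁ := by
  refine (withDensity_absolutelyContinuous _ _).trans ?_
  refine withDensity_absolutelyContinuous' (I.measurable_f x₁).ennreal_ofReal.aemeasurable ?_
  exact ae_of_all _ fun s => by simpa using I.pos s x₁

lemma actionLaw_absolutelyContinuous (I : SignalStructure Ω S) (σ : StrategyProfile S A)
    (x₀ x₁ : Ω) (l : List A) : actionLaw I σ x₀ l ≪ actionLaw I σ x₁ l :=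
  (signalLaw_absolutelyContinuous I x₀ x₁).comp_right _

variable [DiscreteMeasurableSpace 𝒜]

lemma measurableSet_cyl (p : ℕ → A) (n : ℕ) : MeasurableSet (cyl p n) := by
  have : cyl p n = ⋂ i, ⋂ (_ : i < n), (fun q : ℕ → A => q i) ⁻¹' {p i} := by
    ext q; simp [cyl]
  rw [this]
  exact .iInter fun i => .iInter fun _ => measurable_pi_apply i (measurableSet_singleton _)

variable [Countable A]

/-- The case split reflects the construction: action `0` comes from the initial measure, and action
`n + 1` from `stepKernel` at index `n`. -/
lemma pathKernel_cyl_succ (I : SignalStructure Ω S) (σ : StrategyProfile S A) (ω : Ω)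
    (p : ℕ → A) (n : ℕ) :
    pathKernel I σ ω (cyl p (n + 1)) =
      pathKernel I σ ω (cyl p n) * actionLaw I σ ω (hist p n) {p n} := by
  change Kernel.trajMeasure (X := fun _ => A) (actionLaw I σ ω []) (stepKernel I σ ω) _ =
    Kernel.trajMeasure (X := fun _ => A) (actionLaw I σ ω []) (stepKernel I σ ω) _ * _
  set P := Kernel.trajMeasure (X := fun _ => A) (actionLaw I σ ω []) (stepKernel I σ ω) with hP
  cases n with
  | zero =>
    have h0 : P.map (Preorder.frestrictLe 0) =
        (actionLaw I σ ω []).map (MeasurableEquiv.piUnique _).symm := by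
      rw [hP, Kernel.trajMeasure, Measure.map_comp _ _ (by fun_prop),
        Kernel.traj_map_frestrictLe, Kernel.partialTraj_self, Measure.id_comp]
    have h1 : P.map (fun q => q 0) = actionLaw I σ ω [] := by
      have := congrArg (fun m => m.map (fun q : Finset.Iic 0 → A => q ⟨0, by simp⟩)) h0
      rw [Measure.map_map (by fun_prop) (by fun_prop),
        Measure.map_map (by fun_prop) (by fun_prop)] at this
      refine this.trans ?_
      exact Measure.map_id
    have h2 : cyl p (0 + 1) = (fun q : ℕ → A => q 0) ⁻¹' {p 0} := by
      rw [cyl_succ, cyl_zero, Set.univ_inter]; rfl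
    rw [cyl_zero, measure_univ, one_mul, h2,
      ← Measure.map_apply (measurable_pi_apply 0) (measurableSet_singleton _), h1]
    rfl
  | succ n =>
    have h := Kernel.map_frestrictLe_trajMeasure_compProd_eq_map_trajMeasure
      (X := fun _ => A) (μ₀ := actionLaw I σ ω []) (κ := stepKernel I σ ω) (a := n)
    have h' := congrArg (fun m => m ({Preorder.frestrictLe n p} ×ˢ {p (n + 1)})) h
    rw [Measure.map_apply (by fun_prop) ((measurableSet_singleton _).prod
        (measurableSet_singleton _)), Measure.compProd_apply_prod (measurableSet_singleton _)
        (measurableSet_singleton _), lintegral_singleton, Measure.map_apply (by fun_prop)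
        (measurableSet_singleton _)] at h'
    have e1 : Preorder.frestrictLe (π := fun _ => A) n ⁻¹' {Preorder.frestrictLe n p} =
        cyl p (n + 1) := by
      ext q
      simp only [Set.mem_preimage, Set.mem_singleton_iff, funext_iff, cyl, Set.mem_ofPred_eq]
      exact ⟨fun hq i hi => hq ⟨i, Finset.mem_Iic.2 (by omega)⟩,
        fun hq i => hq i (Nat.lt_succ_iff.2 (Finset.mem_Iic.1 i.2))⟩
    have e2 : (fun x : ℕ → A => (Preorder.frestrictLe (π := fun _ => A) n x, x (n + 1))) ⁻¹'
        ({Preorder.frestrictLe n p} ×ˢ {p (n + 1)}) = cyl p (n + 1 + 1) := by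
      rw [cyl_succ p (n + 1), ← e1]
      ext q; simp
    rw [e1, e2] at h'
    rw [← h', mul_comm]
    rfl

lemma pathKernel_cyl_eq_prod (I : SignalStructure Ω S) (σ : StrategyProfile S A) (ω : Ω)
    (p : ℕ → A) (n : ℕ) :
    pathKernel I σ ω (cyl p n) = ∏ k ∈ Finset.range n, actionLaw I σ ω (hist p k) {p k} := by
  induction n with
  | zero => simp [cyl_zero]
  | succ n ih => rw [pathKernel_cyl_succ, ih, Finset.prod_range_succ]

lemma tendsto_pathKernel_cyl (I : SignalStructure Ω S) (σ : StrategyProfile S A) (ω : Ω)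
    (p : ℕ → A) :
    Tendsto (fun n => pathKernel I σ ω (cyl p n)) atTop (𝓝 (pathKernel I σ ω {p})) := by
  rw [← iInter_cyl]
  exact tendsto_measure_iInter_atTop (fun n => (measurableSet_cyl p n).nullMeasurableSet)
    (cyl_antitone p) ⟨0, measure_ne_top _ _⟩

lemma pathKernel_congr {I : SignalStructure Ω S} {σ τ : StrategyProfile S A} {p : ℕ → A} {n : ℕ}
    (h : ∀ k < n, τ.act (hist p k) = σ.act (hist p k)) (ω : Ω) :
    pathKernel I τ ω (cyl p n) = pathKernel I σ ω (cyl p n) := by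
  rw [pathKernel_cyl_eq_prod, pathKernel_cyl_eq_prod]
  refine Finset.prod_congr rfl fun k hk => ?_
  rw [actionLaw, actionLaw, h k (Finset.mem_range.1 hk)]

/-! ### Comparison of the path laws in two states -/

lemma signalLaw_le_smul {I : SignalStructure Ω S} {x₀ x₁ : Ω} {c : ℝ} (hc : 0 < c)
    (h : ∀ᵐ s ∂(refMeasure S), c * I.f s x₁ ≤ I.f s x₀) :
    I.signalLaw x₁ ≤ ENNReal.ofReal c⁻¹ • I.signalLaw x₀ := by
  rw [SignalStructure.signalLaw, SignalStructure.signalLaw,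
    ← withDensity_smul _ (I.measurable_f x₀).ennreal_ofReal]
  refine withDensity_mono ?_
  filter_upwards [h] with s hs
  rw [Pi.smul_apply, smul_eq_mul, ← ENNReal.ofReal_mul (by positivity)]
  refine ENNReal.ofReal_le_ofReal ?_
  rw [inv_mul_eq_div, le_div_iff₀ hc]
  linarith

/-- Strategies do not depend on the state, so domination of the signal laws passes to actions, with
one constant for all profiles and histories. -/
lemma actionLaw_le_mul {I : SignalStructure Ω S} {x₀ x₁ : Ω} {c : ℝ} (hc : 0 < c)
    (h : ∀ᵐ s ∂(refMeasure S), c * I.f s x₁ ≤ I.f s x₀) (σ : StrategyProfile S A) (l : List A)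
    (B : Set A) :
    actionLaw I σ x₁ l B ≤ ENNReal.ofReal c⁻¹ * actionLaw I σ x₀ l B := by
  have hB : MeasurableSet B := B.to_countable.measurableSet
  rw [actionLaw, actionLaw, Measure.bind_apply hB (σ.act l).aemeasurable,
    Measure.bind_apply hB (σ.act l).aemeasurable, ← smul_eq_mul, ← lintegral_smul_measure]
  exact lintegral_mono' (signalLaw_le_smul hc h) le_rfl

/-- If the likelihood ratio of `x₀` to `x₁` is bounded away from zero, then every path that has
positive probability in state `x₀` has positive probability in state `x₁`. -/
lemma pathKernel_singleton_pos {I : SignalStructure Ω S} {x₀ x₁ : Ω} {c : ℝ} (hc : 0 < c)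
    (h : ∀ᵐ s ∂(refMeasure S), c * I.f s x₁ ≤ I.f s x₀) (σ : StrategyProfile S A) {p : ℕ → A}
    (hp : 0 < pathKernel I σ x₀ {p}) : 0 < pathKernel I σ x₁ {p} := by
  set α : Ω → ℕ → ℝ := fun x k => (actionLaw I σ x (hist p k)).real {p k} with hα
  have hprod (x : Ω) (n : ℕ) : (pathKernel I σ x).real (cyl p n) =
      ∏ k ∈ Finset.range n, α x k := by
    rw [measureReal_def, pathKernel_cyl_eq_prod, ENNReal.toReal_prod]; rfl
  have htend (x : Ω) : Tendsto (fun n => ∏ k ∈ Finset.range n, α x k) atTop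
      (𝓝 ((pathKernel I σ x).real {p})) := by
    simp_rw [← hprod]
    exact (ENNReal.tendsto_toReal (measure_ne_top _ _)).comp (tendsto_pathKernel_cyl I σ x p)
  have hcompl (x : Ω) (k : ℕ) : 1 - α x k = (actionLaw I σ x (hist p k)).real {p k}ᶜ := by
    rw [probReal_compl_eq_one_sub (measurableSet_singleton _)]
  have hα0 (x k) : 0 ≤ α x k := measureReal_nonneg
  set π := (pathKernel I σ x₀).real {p} with hπ
  have hπ0 : 0 < π := ENNReal.toReal_pos hp.ne' (measure_ne_top _ _)
  have hpos0 (k : ℕ) : 0 < α x₀ k := by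
    refine (hα0 _ _).lt_of_ne' fun h0 => ?_
    have : Tendsto (fun n => ∏ k ∈ Finset.range n, α x₀ k) atTop (𝓝 0) := by
      refine tendsto_const_nhds.congr' ?_
      filter_upwards [eventually_gt_atTop k] with n hn
      exact (Finset.prod_eq_zero (Finset.mem_range.2 hn) h0).symm
    exact hπ0.ne' (tendsto_nhds_unique (htend x₀) this)
  -- Domination bounds `α x₁ k` only from above, so positivity of the single factors needs absolute
  -- continuity.
  have hpos1 (k : ℕ) : 0 < α x₁ k := by
    refine ENNReal.toReal_pos (fun h0 => ?_) (measure_ne_top _ _)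
    have := actionLaw_absolutelyContinuous I σ x₀ x₁ (hist p k) h0
    exact (hpos0 k).ne' (by simp [hα, measureReal_def, this])
  -- Since `log t ≤ t - 1`, the partial sums are at most minus the logarithm of a partial product,
  -- hence at most `-log π`.
  have hsum0 : Summable fun k => 1 - α x₀ k := by
    refine summable_of_sum_range_le (c := -Real.log π)
      (fun k => by rw [hcompl]; exact measureReal_nonneg) fun n => ?_
    have h1 : π ≤ ∏ k ∈ Finset.range n, α x₀ k := by
      rw [← hprod]
      exact measureReal_mono (Set.singleton_subset_iff.2 (mem_cyl_self p n))
    have h2 := Real.log_le_log hπ0 h1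
    rw [Real.log_prod (fun k _ => (hpos0 k).ne')] at h2
    have h3 : ∑ k ∈ Finset.range n, Real.log (α x₀ k) ≤ ∑ k ∈ Finset.range n, -(1 - α x₀ k) :=
      Finset.sum_le_sum fun k _ => by
        have := Real.log_le_sub_one_of_pos (hpos0 k); linarith
    rw [Finset.sum_neg_distrib] at h3
    linarith
  have hsum1 : Summable fun k => 1 - α x₁ k := by
    refine Summable.of_nonneg_of_le (fun k => by rw [hcompl]; exact measureReal_nonneg)
      (fun k => ?_) (hsum0.mul_left c⁻¹)
    -- The comparison is applied to the event of leaving the path; applied to the event of staying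
    -- on it, it would say nothing about the product.
    rw [hcompl, hcompl]
    have := ENNReal.toReal_mono (by finiteness) (actionLaw_le_mul hc h σ (hist p k) {p k}ᶜ)
    rwa [ENNReal.toReal_mul, ENNReal.toReal_ofReal (by positivity)] at this
  have hsum1' : Summable fun k => ‖α x₁ k - 1‖ := by
    refine (hsum1.norm).congr fun k => norm_sub_rev _ _
  have hne := tprod_one_add_ne_zero_of_summable (f := fun k => α x₁ k - 1)
    (fun k => by simpa using (hpos1 k).ne') hsum1'
  have hm := (multipliable_one_add_of_summable hsum1').hasProd.tendsto_prod_nat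
  simp only [add_sub_cancel] at hm hne
  have heq := tendsto_nhds_unique (htend x₁) hm
  rw [← heq] at hne
  exact pos_iff_ne_zero.2 fun h0 => hne (by simp [measureReal_def, h0])

end

section

variable {Ω : Set ℤ} {S : Set ℝ} {𝒜 : Type*} {A : Set 𝒜} [MeasurableSpace 𝒜]

/-! ### Limits of the public beliefs -/

/-- The information revealed by the first `n` actions. -/
def actionFiltration (Ω : Set ℤ) (A : Set 𝒜) :
    Filtration ℕ (inferInstance : MeasurableSpace (Ω × (ℕ → A))) where
  seq n := MeasurableSpace.comap (fun y (i : Fin n) => y.2 i) inferInstance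
  mono' n m hnm := by
    have : (fun (y : Ω × (ℕ → A)) (i : Fin n) => y.2 i) =
        (fun (z : Fin m → A) (i : Fin n) => z (Fin.castLE hnm i)) ∘
          fun y (i : Fin m) => y.2 i := rfl
    beta_reduce
    rw [this, ← MeasurableSpace.comap_comp]
    exact MeasurableSpace.comap_mono (Measurable.comap_le (by fun_prop))
  le' n := Measurable.comap_le (by fun_prop)

/-- Identifies the limit in Lévy's upward theorem as conditioning on the whole path of actions. -/
lemma iSup_actionFiltration (Ω : Set ℤ) (A : Set 𝒜) :
    ⨆ n, actionFiltration Ω A n = MeasurableSpace.comap (Prod.snd : Ω × (ℕ → A) → _) inferInstance := by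
  refine le_antisymm (iSup_le fun n => ?_) ?_
  · have : (fun (y : Ω × (ℕ → A)) (i : Fin n) => y.2 i) =
        (fun (z : ℕ → A) (i : Fin n) => z i) ∘ Prod.snd := rfl
    change MeasurableSpace.comap _ _ ≤ _
    rw [this, ← MeasurableSpace.comap_comp]
    exact MeasurableSpace.comap_mono (Measurable.comap_le (by fun_prop))
  · refine Measurable.comap_le ?_
    refine @measurable_pi_lambda _ _ _ (_) _ _ fun i => ?_
    refine Measurable.mono (ma := actionFiltration Ω A (i + 1)) ?_
      (le_iSup (fun n => actionFiltration Ω A n) (i + 1)) le_rfl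
    have : (fun y : Ω × (ℕ → A) => y.2 i) =
        (fun z : Fin (i + 1) → A => z (Fin.last i)) ∘ fun y (j : Fin (i + 1)) => y.2 j := rfl
    rw [this]
    exact (measurable_pi_apply _).comp (comap_measurable _)

variable [DiscreteMeasurableSpace 𝒜] [Countable A]

lemma outcomeLaw_prod (μ₀ : PMF Ω) (I : SignalStructure Ω S) (σ : StrategyProfile S A)
    (x : Ω) {E : Set (ℕ → A)} (hE : MeasurableSet E) :
    outcomeLaw μ₀ I σ ({x} ×ˢ E) = μ₀ x * pathKernel I σ x E := by
  rw [outcomeLaw, Measure.compProd_apply_prod (measurableSet_singleton _) hE,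
    lintegral_singleton, PMF.toMeasure_apply_singleton _ _ (measurableSet_singleton _), mul_comm]

lemma publicBelief_eq (μ₀ : PMF Ω) (I : SignalStructure Ω S) (σ : StrategyProfile S A)
    (p : ℕ → A) (n : ℕ) (x : Ω) :
    publicBelief μ₀ I σ p n x = (outcomeLaw μ₀ I σ)[Prod.fst ⁻¹' {x} | Prod.snd ⁻¹' cyl p n] :=
  rfl

/-- A path of positive probability reveals only that it was followed, so that no state in which
the path has positive probability is excluded in the limit. -/
lemma mem_inadequateLimit {u : 𝒜 → Ω → ℝ} {μ₀ : PMF Ω} {I : SignalStructure Ω S}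
    {σ : StrategyProfile S A} {p : ℕ → A} {x₀ x₁ : Ω}
    (h₀ : 0 < outcomeLaw μ₀ I σ ({x₀} ×ˢ {p})) (h₁ : 0 < outcomeLaw μ₀ I σ ({x₁} ×ˢ {p}))
    (hu : ∀ μ : PMF Ω, x₀ ∈ μ.support → x₁ ∈ μ.support → ¬ AdequateKnowledge u A μ)
    {y : Ω × (ℕ → A)} (hy : y.2 = p) : y ∈ inadequateLimit u μ₀ I σ := by
  set M := outcomeLaw μ₀ I σ with hM
  have hE : MeasurableSet (Prod.snd ⁻¹' {p} : Set (Ω × (ℕ → A))) :=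
    measurable_snd (measurableSet_singleton p)
  have hle (x : Ω) : ({x} ×ˢ {p} : Set (Ω × (ℕ → A))) = Prod.snd ⁻¹' {p} ∩ Prod.fst ⁻¹' {x} := by
    ext z; simp [Prod.ext_iff, and_comm]
  have hEpos : M (Prod.snd ⁻¹' {p}) ≠ 0 := fun h =>
    h₀.ne' (measure_mono_null (by rw [hle]; exact Set.inter_subset_left) h)
  have : IsProbabilityMeasure M[|Prod.snd ⁻¹' {p}] := cond_isProbabilityMeasure hEpos
  have : IsProbabilityMeasure (M[|Prod.snd ⁻¹' {p}].map Prod.fst) :=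
    Measure.isProbabilityMeasure_map measurable_fst.aemeasurable
  set μ : PMF Ω := (M[|Prod.snd ⁻¹' {p}].map Prod.fst).toPMF with hμ
  have hμx (x : Ω) : μ x = (M (Prod.snd ⁻¹' {p}))⁻¹ * M ({x} ×ˢ {p}) := by
    rw [hμ, Measure.toPMF_apply, Measure.map_apply measurable_fst (measurableSet_singleton _),
      cond_apply hE, hle]
  have hsupp {x : Ω} (h : 0 < M ({x} ×ˢ {p})) : x ∈ μ.support := by
    rw [PMF.mem_support_iff, hμx]
    exact mul_ne_zero (ENNReal.inv_ne_zero.2 (measure_ne_top _ _)) h.ne'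
  refine ⟨μ, fun x => ?_, hu μ (hsupp h₀) (hsupp h₁)⟩
  have hlim (D : Set (Ω × (ℕ → A))) (hD : MeasurableSet D) :
      Tendsto (fun n => M (Prod.snd ⁻¹' cyl p n ∩ D)) atTop (𝓝 (M (Prod.snd ⁻¹' {p} ∩ D))) := by
    rw [← iInter_cyl, Set.preimage_iInter, Set.iInter_inter]
    exact tendsto_measure_iInter_atTop
      (fun n => ((measurable_snd (measurableSet_cyl p n)).inter hD).nullMeasurableSet)
      (fun i j hij => Set.inter_subset_inter_left _ (Set.preimage_mono (cyl_antitone p hij)))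
      ⟨0, measure_ne_top _ _⟩
  simp_rw [publicBelief_eq, ← hM, hy, cond_apply (measurable_snd (measurableSet_cyl p _))]
  rw [hμx, hle]
  refine ENNReal.Tendsto.mul ?_ (.inl (ENNReal.inv_ne_zero.2 (measure_ne_top _ _)))
    (hlim _ (measurable_fst (measurableSet_singleton x)))
    (.inr (ENNReal.inv_ne_top.2 hEpos))
  have := hlim _ MeasurableSet.univ
  simp only [Set.inter_univ] at this
  exact tendsto_inv_iff.2 this

/-- The public beliefs converge to the conditional distribution of the state given all actions. -/
lemma ae_tendsto_publicBelief [Nonempty Ω] (M : Measure (Ω × (ℕ → A))) [IsProbabilityMeasure M]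
    (D : Set Ω) :
    ∀ᵐ y ∂M, Tendsto (fun n => M[Prod.fst ⁻¹' D | Prod.snd ⁻¹' cyl y.2 n]) atTop
      (𝓝 (condDistrib Prod.fst Prod.snd M y.2 D)) := by
  have hD : MeasurableSet D := D.to_countable.measurableSet
  set X : (n : ℕ) → Ω × (ℕ → A) → Fin n → A := fun n y i => y.2 i with hX
  have hXm (n : ℕ) : Measurable (X n) := by fun_prop
  have hlevy := tendsto_ae_condExp (μ := M) (ℱ := actionFiltration Ω A)
    ((Prod.fst ⁻¹' D).indicator fun _ => (1 : ℝ))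
  rw [iSup_actionFiltration] at hlevy
  -- The conditional distribution is given by Bayes' rule only at histories of positive probability;
  -- there are countably many histories, so the others form a null set.
  have hatoms : ∀ᵐ y ∂M, ∀ n, M.map (X n) {X n y} ≠ 0 := by
    rw [ae_all_iff]
    intro n
    have : ∀ᵐ z ∂(M.map (X n)), M.map (X n) {z} ≠ 0 := by
      rw [ae_iff, ← Set.biUnion_of_singleton {z | ¬ M.map (X n) {z} ≠ 0}]
      exact (measure_biUnion_null_iff (Set.to_countable _)).2 fun z hz => not_not.1 hz
    exact ae_of_ae_map (hXm n).aemeasurable this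
  filter_upwards [hlevy, hatoms, condDistrib_ae_eq_condExp (μ := M) measurable_snd measurable_fst hD,
    ae_all_iff.2 fun n => condDistrib_ae_eq_condExp (μ := M) (hXm n) measurable_fst hD]
    with y h1 h2 h3 h4
  rw [← ENNReal.tendsto_toReal_iff (fun _ => measure_ne_top _ _) (measure_ne_top _ _)]
  change Tendsto _ _ (𝓝 ((condDistrib Prod.fst Prod.snd M y.2).real D))
  rw [h3]
  refine h1.congr fun n => ?_
  refine (h4 n).symm.trans ?_
  rw [measureReal_def, condDistrib_apply_of_ne_zero measurable_fst _ (h2 n)]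
  have e : X n ⁻¹' {X n y} = Prod.snd ⁻¹' cyl y.2 n := by
    ext z
    simp only [hX, Set.mem_preimage, Set.mem_singleton_iff, funext_iff, cyl, Set.mem_ofPred_eq]
    exact ⟨fun h i hi => h ⟨i, hi⟩, fun h i => h i i.2⟩
  rw [Measure.map_apply (hXm n) (measurableSet_singleton _), Measure.map_apply
    ((hXm n).prodMk measurable_fst) ((measurableSet_singleton _).prod hD), Set.mk_preimage_prod, e,
    cond_apply (measurable_snd (measurableSet_cyl _ _))]

end

section

variable {Ω : Set ℤ} {S : Set ℝ} {𝒜 : Type*} {A : Set 𝒜} [MeasurableSpace 𝒜]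

/-! ### Deviations -/

/-- The strategy profile obtained from `σ` by choosing `α` after the history `l`. -/
def deviate (σ : StrategyProfile S A) (l : List A) (α : A) : StrategyProfile S A where
  act h := open Classical in if h = l then Kernel.const S (Measure.dirac α) else σ.act h
  isMarkov h := by
    split_ifs
    · infer_instance
    · exact σ.isMarkov h

lemma deviate_act_of_ne (σ : StrategyProfile S A) {h l : List A} (α : A) (hl : h ≠ l) :
    (deviate σ l α).act h = σ.act h := if_neg hl

variable [DiscreteMeasurableSpace 𝒜]

lemma actionLaw_deviate_self (I : SignalStructure Ω S) (σ : StrategyProfile S A) (l : List A)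
    (α : A) (x : Ω) : actionLaw I (deviate σ l α) x l {α} = 1 := by
  have : (deviate σ l α).act l = Kernel.const S (Measure.dirac α) := if_pos rfl
  rw [actionLaw, this, Measure.const_comp, measure_univ, one_smul]
  simp

variable [Countable A]

/-- Two measures agree on a set of paths determined by the first `n` actions if they agree on its
cylinders. -/
lemma measure_eq_of_cyl {μ ν : Measure (ℕ → A)} {n : ℕ} {E : Set (ℕ → A)}
    (hE : ∀ q ∈ E, cyl q n ⊆ E) (h : ∀ q ∈ E, μ (cyl q n) = ν (cyl q n)) : μ E = ν E := by
  set f : (ℕ → A) → Fin n → A := fun q i => q i with hf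
  have hfm : Measurable f := by fun_prop
  have hfib (q : ℕ → A) : f ⁻¹' {f q} = cyl q n := by
    ext z
    simp only [hf, Set.mem_preimage, Set.mem_singleton_iff, funext_iff, cyl, Set.mem_ofPred_eq]
    exact ⟨fun h i hi => h ⟨i, hi⟩, fun h i => h i i.2⟩
  have hEf : E = f ⁻¹' (f '' E) := by
    refine (Set.subset_preimage_image f E).antisymm ?_
    rintro z ⟨q, hq, hqz⟩
    refine hE q hq ?_
    rw [← hfib]
    exact hqz.symm
  rw [hEf, ← tsum_measure_preimage_singleton (Set.to_countable _)
    fun _ _ => hfm (measurableSet_singleton _), ← tsum_measure_preimage_singleton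
    (Set.to_countable _) fun _ _ => hfm (measurableSet_singleton _)]
  refine tsum_congr ?_
  rintro ⟨_, q, hq, rfl⟩
  change μ (f ⁻¹' {f q}) = ν (f ⁻¹' {f q})
  rw [hfib, h q hq]

lemma measurableSet_apply_eq (n : ℕ) (α : A) : MeasurableSet {q : ℕ → A | q n = α} :=
  measurableSet_eq_fun (measurable_pi_apply n) measurable_const

/-- Away from the history `hist p n` nothing changes up to time `n`; on it `α` is now chosen surely.
The gain is exactly the event that the history occurs and `σ` does not choose `α`. -/
lemma pathKernel_deviate (I : SignalStructure Ω S) (σ : StrategyProfile S A) (p : ℕ → A) (n : ℕ)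
    (α : A) (x : Ω) :
    pathKernel I (deviate σ (hist p n) α) x {q | q n = α} =
      pathKernel I σ x {q | q n = α} + pathKernel I σ x (cyl p n ∩ {q | q n ≠ α}) := by
  set τ := deviate σ (hist p n) α with hτ
  set E : Set (ℕ → A) := {q | q n = α} with hE
  have hEm : MeasurableSet E := measurableSet_apply_eq n α
  have hC := measurableSet_cyl p n
  have hτk (q : ℕ → A) {k : ℕ} (hk : k < n) : τ.act (hist q k) = σ.act (hist q k) := by
    refine deviate_act_of_ne σ α fun he => hk.ne ?_
    simpa [length_hist] using congrArg List.length he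
  have h1 : pathKernel I τ x (E ∩ cyl p n) = pathKernel I σ x (cyl p n) := by
    set p' : ℕ → A := Function.update p n α with hp'
    have hpp : p' ∈ cyl p n := fun i hi => by simp [hp', hi.ne]
    have : E ∩ cyl p n = cyl p' (n + 1) := by
      rw [cyl_succ, cyl_congr hpp, Set.inter_comm]; simp [hp', hE]
    rw [this, pathKernel_cyl_succ, (hist_eq_iff p p' n).2 hpp, cyl_congr hpp,
      pathKernel_congr fun k hk => hτk p hk]
    simp [hp', hτ, actionLaw_deviate_self]
  have h2 : pathKernel I τ x (E \ cyl p n) = pathKernel I σ x (E \ cyl p n) := by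
    refine measure_eq_of_cyl (n := n + 1) (fun q hq r hr => ⟨?_, fun hrp => hq.2 ?_⟩) fun q hq => ?_
    · exact (hr n n.lt_succ_self).trans hq.1
    · exact fun i hi => (hr i (by omega)).symm.trans (hrp i hi)
    · refine pathKernel_congr (fun k hk => ?_) x
      obtain hk | rfl := Nat.lt_succ_iff_lt_or_eq.1 hk
      · exact hτk q hk
      · exact deviate_act_of_ne σ α fun he => hq.2 ((hist_eq_iff p q _).1 he)
  have h3 : cyl p n ∩ {q | q n ≠ α} = cyl p n \ E := by ext; simp [hE]
  rw [← measure_inter_add_sdiff E hC, h1, h2, h3, ← measure_inter_add_sdiff E hC,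
    ← measure_inter_add_sdiff (cyl p n) hEm, Set.inter_comm E]
  ring

lemma outcomeLaw_deviate (μ₀ : PMF Ω) (I : SignalStructure Ω S) (σ : StrategyProfile S A)
    (p : ℕ → A) (n : ℕ) (α : A) (D : Set Ω) :
    outcomeLaw μ₀ I (deviate σ (hist p n) α) (D ×ˢ {q | q n = α}) =
      outcomeLaw μ₀ I σ (D ×ˢ {q | q n = α}) +
        outcomeLaw μ₀ I σ (D ×ˢ (cyl p n ∩ {q | q n ≠ α})) := by
  have hD : MeasurableSet D := D.to_countable.measurableSet
  have hE : MeasurableSet {q : ℕ → A | q n = α} := measurableSet_apply_eq n α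
  have hF : MeasurableSet (cyl p n ∩ {q | q n ≠ α}) := (measurableSet_cyl p n).inter hE.compl
  simp only [outcomeLaw]
  rw [Measure.compProd_apply_prod hD hE, Measure.compProd_apply_prod hD hE,
    Measure.compProd_apply_prod hD hF, ← lintegral_add_left (Kernel.measurable_coe _ hE)]
  simp_rw [pathKernel_deviate]

/-- The payoff when the choice set is `{α, β}` and the two utilities differ by one. -/
lemma payoff_eq {u : 𝒜 → Ω → ℝ} {α β : A} (hA : ∀ c : A, c = α ∨ c = β) {L : Set Ω}
    (hL : ∀ x ∈ L, u α x - u β x = 1) (hL' : ∀ x ∉ L, u α x - u β x = -1)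
    (hu : ∃ C, ∀ x, |u β x| ≤ C) (μ₀ : PMF Ω) (I : SignalStructure Ω S)
    (σ : StrategyProfile S A) (n : ℕ) :
    payoff u μ₀ I σ n = ∫ x, u β x ∂μ₀.toMeasure +
      (outcomeLaw μ₀ I σ).real (L ×ˢ {q | q n = α}) -
      (outcomeLaw μ₀ I σ).real (Lᶜ ×ˢ {q | q n = α}) := by
  classical
  set M := outcomeLaw μ₀ I σ with hM
  have hE : MeasurableSet {q : ℕ → A | q n = α} := measurableSet_apply_eq n α
  have hLm : MeasurableSet (L ×ˢ {q : ℕ → A | q n = α}) := L.to_countable.measurableSet.prod hE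
  have hLm' : MeasurableSet (Lᶜ ×ˢ {q : ℕ → A | q n = α}) :=
    Lᶜ.to_countable.measurableSet.prod hE
  have hdec : (fun y : Ω × (ℕ → A) => u (y.2 n) y.1) = fun y => u β y.1 +
      (L ×ˢ {q : ℕ → A | q n = α}).indicator (fun _ => (1 : ℝ)) y -
      (Lᶜ ×ˢ {q : ℕ → A | q n = α}).indicator (fun _ => (1 : ℝ)) y := by
    funext y
    by_cases hy : y.2 n = α
    · by_cases hx : y.1 ∈ L
      · have := hL _ hx
        simp [Set.indicator, hy, hx]; linarith
      · have := hL' _ hx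
        simp [Set.indicator, hy, hx]; linarith
    · have := (hA (y.2 n)).resolve_left hy
      simp only [Set.indicator, Set.mem_prod, Set.mem_ofPred_eq, hy, and_false, if_false, add_zero,
        sub_zero]
      rw [this]
  have hint : Integrable (fun y : Ω × (ℕ → A) => u β y.1) M := by
    obtain ⟨C, hC⟩ := hu
    exact .of_bound ((Measurable.of_discrete (f := u β)).comp measurable_fst).aestronglyMeasurable
      C (ae_of_all _ fun y => hC y.1)
  have hfst : M.map Prod.fst = μ₀.toMeasure := Measure.fst_compProd _ _
  have hβ : ∫ y, u β y.1 ∂M = ∫ x, u β x ∂μ₀.toMeasure := by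
    rw [← hfst, integral_map measurable_fst.aemeasurable
      (Measurable.of_discrete (f := u β)).aestronglyMeasurable]
  have hi := (integrable_const (μ := M) (1 : ℝ)).indicator hLm
  have hi' := (integrable_const (μ := M) (1 : ℝ)).indicator hLm'
  have hadd : Integrable (fun y : Ω × (ℕ → A) => u β y.1 +
      (L ×ˢ {q : ℕ → A | q n = α}).indicator (fun _ => (1 : ℝ)) y) M := hint.add hi
  rw [payoff, hdec, integral_sub hadd hi', integral_add hint hi,
    integral_indicator_const _ hLm, integral_indicator_const _ hLm', hβ]
  simp [hM]

/-- In equilibrium, deviating to `α` after a history does not pay: whenever `β` is chosen, it is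
more likely to be right than wrong. -/
lemma IsEquilibrium.outcomeLaw_le {u : 𝒜 → Ω → ℝ} {α β : A} (hA : ∀ c : A, c = α ∨ c = β)
    {L : Set Ω} (hL : ∀ x ∈ L, u α x - u β x = 1) (hL' : ∀ x ∉ L, u α x - u β x = -1)
    (hu : ∃ C, ∀ x, |u β x| ≤ C) {μ₀ : PMF Ω} {I : SignalStructure Ω S}
    {σ : StrategyProfile S A} (hσ : IsEquilibrium u μ₀ I σ) (p : ℕ → A) (n : ℕ) :
    outcomeLaw μ₀ I σ (L ×ˢ (cyl p n ∩ {q | q n ≠ α})) ≤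
      outcomeLaw μ₀ I σ (Lᶜ ×ˢ (cyl p n ∩ {q | q n ≠ α})) := by
  have h := hσ n (deviate σ (hist p n) α) fun l hl => deviate_act_of_ne σ α fun he => hl <| by
    rw [he, length_hist]
  rw [payoff_eq hA hL hL' hu, payoff_eq hA hL hL' hu] at h
  -- What both profiles share cancels: the deviation gains the mass of the switched paths in `L` and
  -- loses that in its complement.
  simp only [measureReal_def, outcomeLaw_deviate] at h
  rw [ENNReal.toReal_add (measure_ne_top _ _) (measure_ne_top _ _),
    ENNReal.toReal_add (measure_ne_top _ _) (measure_ne_top _ _)] at h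
  rw [← ENNReal.toReal_le_toReal (measure_ne_top _ _) (measure_ne_top _ _)]
  linarith

end

section

variable {Ω : Set ℤ} {S : Set ℝ} {𝒜 : Type*} {A : Set 𝒜}

/-! ### Inadequate learning when one state cannot be separated from another -/

lemma expectedUtility_pure (u : 𝒜 → Ω → ℝ) (x : Ω) (c : 𝒜) :
    expectedUtility u (PMF.pure x) c = u c x := by
  rw [expectedUtility, tsum_eq_single x fun y hy => by simp [PMF.pure_apply, hy]]
  simp

lemma not_adequateKnowledge {u : 𝒜 → Ω → ℝ} {α β : A} (hA : ∀ c : A, c = α ∨ c = β) {x y : Ω}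
    (hx : u β x < u α x) (hy : u α y < u β y) {μ : PMF Ω} (hxμ : x ∈ μ.support)
    (hyμ : y ∈ μ.support) : ¬ AdequateKnowledge u A μ := by
  rintro ⟨c, hc⟩
  simp only [Set.mem_iInter] at hc
  obtain ⟨hcA, hcx⟩ := hc x hxμ
  obtain ⟨-, hcy⟩ := hc y hyμ
  have h1 := hcx α α.2
  have h2 := hcy β β.2
  rw [expectedUtility_pure, expectedUtility_pure] at h1 h2
  obtain h | h := hA ⟨c, hcA⟩
  · obtain rfl : c = α := congrArg Subtype.val h
    linarith
  · obtain rfl : c = β := congrArg Subtype.val h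
    linarith

variable [MeasurableSpace 𝒜] [DiscreteMeasurableSpace 𝒜] [Countable A]

/-- If the limit of the public beliefs has adequate knowledge almost surely, then after some
history it is more likely that the state is `x₀` than that `β` is right. -/
lemma exists_cyl_lt {u : 𝒜 → Ω → ℝ} {L : Set Ω} {x₀ : Ω} {μ₀ : PMF Ω} (hμ₀ : 0 < μ₀ x₀)
    (hu : ∀ x ∉ L, ∀ μ : PMF Ω, x₀ ∈ μ.support → x ∈ μ.support → ¬ AdequateKnowledge u A μ)
    {I : SignalStructure Ω S} {σ : StrategyProfile S A}
    (h0 : outcomeLaw μ₀ I σ (inadequateLimit u μ₀ I σ) = 0) :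
    ∃ (p : ℕ → A) (N : ℕ), outcomeLaw μ₀ I σ (Lᶜ ×ˢ cyl p N) <
      outcomeLaw μ₀ I σ ({x₀} ×ˢ cyl p N) := by
  have : Nonempty Ω := ⟨x₀⟩
  set M := outcomeLaw μ₀ I σ with hM
  set K := condDistrib Prod.fst Prod.snd M with hK
  -- The conditional probability of `x₀` integrates to its prior probability, which is positive.
  have hpos : ∃ᵐ y ∂M, K y.2 {x₀} ≠ 0 := by
    intro hzero
    have h1 : ∫⁻ y, K y.2 {x₀} ∂M = M ({x₀} ×ˢ Set.univ) := by
      have := setLIntegral_preimage_condDistrib (μ := M) (X := Prod.snd) (Y := Prod.fst)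
        (s := {x₀}) (t := Set.univ) measurable_snd measurable_fst.aemeasurable
        (measurableSet_singleton x₀) MeasurableSet.univ
      rw [Set.preimage_univ, Measure.restrict_univ, Set.univ_inter] at this
      rw [Set.prod_univ]
      exact this
    rw [lintegral_congr_ae (g := fun _ => 0) (hzero.mono fun y hy => not_not.1 hy),
      lintegral_zero, hM, outcomeLaw_prod μ₀ I σ x₀ MeasurableSet.univ, measure_univ,
      mul_one] at h1
    exact hμ₀.ne h1
  have hnot : ∀ᵐ y ∂M, y ∉ inadequateLimit u μ₀ I σ := measure_eq_zero_iff_ae_notMem.1 h0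
  obtain ⟨y, hy0, hy, hyx, hyL⟩ := (hpos.and_eventually (hnot.and
    ((ae_all_iff.2 fun x : Ω => ae_tendsto_publicBelief M {x}).and
      (ae_tendsto_publicBelief M Lᶜ)))).exists
  rw [← hK] at hyL
  have hμ (x : Ω) : (K y.2).toPMF x = K y.2 {x} := Measure.toPMF_apply _ _
  -- A state outside `L` charged by the limit belief, together with `x₀`, would put `y` in the
  -- inadequate event.
  have hLzero : K y.2 Lᶜ = 0 := by
    rw [← Set.biUnion_of_singleton Lᶜ, measure_biUnion_null_iff (Set.to_countable _)]
    intro x hx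
    by_contra hne
    refine hy ⟨(K y.2).toPMF, fun x => ?_, hu x hx _ ?_ ?_⟩
    · rw [hμ]; exact hyx x
    · rwa [PMF.mem_support_iff, hμ]
    · rwa [PMF.mem_support_iff, hμ]
  rw [hLzero] at hyL
  obtain ⟨N, hN⟩ := (hyL.eventually_lt (hyx x₀) (pos_iff_ne_zero.2 hy0)).exists
  refine ⟨y.2, N, ?_⟩
  rw [cond_apply (measurable_snd (measurableSet_cyl _ _)),
    cond_apply (measurable_snd (measurableSet_cyl _ _))] at hN
  have := lt_of_mul_lt_mul_left' hN
  rwa [Set.inter_comm, Set.inter_comm _ (Prod.fst ⁻¹' {x₀})] at this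

/-- If after some history `x₀` is more likely than all states in which `β` is right, then with
positive probability in state `x₀` everybody chooses `α` from there on. -/
lemma exists_path_pos {u : 𝒜 → Ω → ℝ} {α β : A} (hA : ∀ c : A, c = α ∨ c = β)
    {L : Set Ω} (hL : ∀ x ∈ L, u α x - u β x = 1) (hL' : ∀ x ∉ L, u α x - u β x = -1)
    (hu : ∃ C, ∀ x, |u β x| ≤ C) {μ₀ : PMF Ω} {I : SignalStructure Ω S}
    {σ : StrategyProfile S A} (hσ : IsEquilibrium u μ₀ I σ) {x₀ : Ω} (hx₀ : x₀ ∈ L)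
    {p : ℕ → A} {N : ℕ}
    (h : outcomeLaw μ₀ I σ (Lᶜ ×ˢ cyl p N) < outcomeLaw μ₀ I σ ({x₀} ×ˢ cyl p N)) :
    ∃ q : ℕ → A, 0 < outcomeLaw μ₀ I σ ({x₀} ×ˢ {q}) := by
  set M := outcomeLaw μ₀ I σ with hM
  set q : ℕ → A := fun i => if i < N then p i else α with hq
  have hqα (n : ℕ) : q (N + n) = α := by simp [hq]
  have hqp : cyl q N = cyl p N := cyl_congr fun i hi => by simp [hq, hi]
  rw [← hqp] at h
  refine ⟨q, pos_iff_ne_zero.2 fun hzero => h.not_ge ?_⟩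
  -- `F n` is the event that the path leaves `q` for the first time at `N + n`.
  set F : ℕ → Set (ℕ → A) := fun n => cyl q (N + n) ∩ {r | r (N + n) ≠ α} with hF
  have hFm (n : ℕ) : MeasurableSet (F n) :=
    (measurableSet_cyl q _).inter (measurableSet_apply_eq _ α).compl
  have hFdisj : Pairwise (Function.onFun Disjoint F) := by
    have hlt {i j : ℕ} (hij : i < j) : Disjoint (F i) (F j) := Set.disjoint_left.2 fun r hi hj =>
      hi.2 ((hj.1 (N + i) (by omega)).trans (hqα i))
    intro i j hij
    obtain h | h := lt_or_gt_of_ne hij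
    exacts [hlt h, (hlt h).symm]
  have hcov : cyl q N ⊆ {q} ∪ ⋃ n, F n := by
    intro r hr
    by_contra hcon
    simp only [Set.mem_union, not_or, Set.mem_iUnion, not_exists] at hcon
    have hr' (n : ℕ) : r ∈ cyl q (N + n) := by
      induction n with
      | zero => exact hr
      | succ n ih =>
        rw [← add_assoc, cyl_succ]
        refine ⟨ih, ?_⟩
        by_contra hne
        exact hcon.2 n ⟨ih, fun he => hne (he.trans (hqα n).symm)⟩
    refine hcon.1 ?_
    rw [← iInter_cyl]
    exact Set.mem_iInter.2 fun n => cyl_antitone q (Nat.le_add_left n N) (hr' n)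
  have hsub : (⋃ n, F n) ⊆ cyl q N := Set.iUnion_subset fun n r hr =>
    cyl_antitone q (Nat.le_add_right N n) hr.1
  have hmeas (D : Set Ω) : M (D ×ˢ ⋃ n, F n) = ∑' n, M (D ×ˢ F n) := by
    rw [Set.prod_iUnion]
    refine measure_iUnion (fun i j hij => ?_) fun n => D.to_countable.measurableSet.prod (hFm n)
    exact Set.disjoint_prod.2 (.inr (hFdisj hij))
  -- If `q` is null in state `x₀`, leaving is almost sure there; the equilibrium inequality for each
  -- `F n` moves this mass to the complement of `L`.
  calc M ({x₀} ×ˢ cyl q N) ≤ M ({x₀} ×ˢ {q} ∪ L ×ˢ ⋃ n, F n) := by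
        refine measure_mono ?_
        refine (Set.prod_mono_right hcov).trans ?_
        rw [Set.prod_union]
        exact Set.union_subset_union_right _
          (Set.prod_mono_left (Set.singleton_subset_iff.2 hx₀))
    _ ≤ M (L ×ˢ ⋃ n, F n) := (measure_union_le _ _).trans (by rw [hzero, zero_add])
    _ ≤ M (Lᶜ ×ˢ ⋃ n, F n) := by
        rw [hmeas, hmeas]
        exact ENNReal.tsum_le_tsum fun n => hσ.outcomeLaw_le hA hL hL' hu q (N + n)
    _ ≤ M (Lᶜ ×ˢ cyl q N) := measure_mono (Set.prod_mono_right hsub)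

/-- Learning is inadequate if, in the choice between `α` and `β`, no signal separates a state in
which `β` is right well from some state in which `α` is right. -/
theorem inadequateLearning_of_bounded_ratio {u : 𝒜 → Ω → ℝ} {α β : A}
    (hA : ∀ c : A, c = α ∨ c = β) {L : Set Ω} (hL : ∀ x ∈ L, u α x - u β x = 1)
    (hL' : ∀ x ∉ L, u α x - u β x = -1) (hu : ∃ C, ∀ x, |u β x| ≤ C) {I : SignalStructure Ω S}
    {x₀ x₁ : Ω} (hx₀ : x₀ ∈ L) (hx₁ : x₁ ∉ L) {c : ℝ} (hc : 0 < c)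
    (hI : ∀ᵐ s ∂(refMeasure S), c * I.f s x₁ ≤ I.f s x₀) {μ₀ : PMF Ω} (hμ₀ : ∀ x, 0 < μ₀ x) :
    InadequateLearning u I μ₀ A := by
  intro σ hσ
  have hadq {x : Ω} (hx : x ∉ L) (μ : PMF Ω) (h : x₀ ∈ μ.support) (h' : x ∈ μ.support) :
      ¬ AdequateKnowledge u A μ :=
    not_adequateKnowledge hA (by linarith [hL x₀ hx₀]) (by linarith [hL' x hx]) h h'
  by_contra hzero
  rw [not_lt, nonpos_iff_eq_zero] at hzero
  obtain ⟨p, N, hpN⟩ := exists_cyl_lt (hμ₀ x₀) (fun x hx => hadq hx) hzero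
  obtain ⟨q, hq⟩ := exists_path_pos hA hL hL' hu hσ hx₀ hpN
  have hq₁ : 0 < outcomeLaw μ₀ I σ ({x₁} ×ˢ {q}) := by
    rw [outcomeLaw_prod _ _ _ _ (measurableSet_singleton q)] at hq ⊢
    exact ENNReal.mul_pos (hμ₀ x₁).ne'
      (pathKernel_singleton_pos hc hI σ (pos_of_mul_pos_right hq zero_le)).ne'
  -- The null inadequate event contains `{x₀} ×ˢ {q}`, which has positive probability.
  refine hq.ne' (measure_mono_null (fun y hy => ?_) hzero)
  exact mem_inadequateLimit hq hq₁ (hadq hx₁) hy.2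

end

section

variable {Ω : Set ℤ} {S : Set ℝ}

/-! ### Failure of directionally unbounded beliefs -/

/-- If countably many positive functions are simultaneously ordered on `T` and none is essentially
bounded away from zero, then they tend to zero together along sets of positive measure. -/
lemma exists_seq_tendsto_zero {X ι : Type*} [MeasurableSpace X] [Countable ι] {ν : Measure X}
    (hν : ν ≠ 0) {T : Set X} (hT : ∀ᵐ s ∂ν, s ∈ T) {r : ι → X → ℝ} (hrm : ∀ i, Measurable (r i))
    (hr0 : ∀ i s, 0 < r i s) (hrb : ∀ s, ∃ C, ∀ i, r i s ≤ C)
    (hmono : ∀ s ∈ T, ∀ s' ∈ T, (∀ i, r i s ≤ r i s') ∨ ∀ i, r i s' ≤ r i s)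
    (hinf : ∀ i, ∀ c > 0, ¬ ∀ᵐ s ∂ν, c ≤ r i s) :
    ∃ C : ℝ, 0 < C ∧ ∃ B : ℕ → Set X, (∀ n, MeasurableSet (B n) ∧ 0 < ν (B n)) ∧
      ∀ s : ℕ → X, (∀ n, s n ∈ B n) → ∀ i,
        Tendsto (fun n => r i (s n)) atTop (𝓝 0) ∧ ∀ n, r i (s n) < C := by
  obtain ⟨T', hT'T, hT'm, hT'⟩ : ∃ T' ⊆ T, MeasurableSet T' ∧ ∀ᵐ s ∂ν, s ∈ T' := by
    obtain ⟨U, hU, hUm, hUT⟩ := eventually_mem_set.1 hT |> mem_ae_iff.1 |>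
      exists_measurable_superset_of_null
    exact ⟨Uᶜ, Set.compl_subset_comm.1 hU, hUm.compl, measure_eq_zero_iff_ae_notMem.1 hUT⟩
  have : (ae ν).NeBot := ae_neBot.2 hν
  have hpos {E : Set X} (hE : ¬ ∀ᵐ s ∂ν, s ∉ E) : 0 < ν E :=
    pos_iff_ne_zero.2 fun h => hE (measure_eq_zero_iff_ae_notMem.1 h)
  have hT'pos : 0 < ν T' := hpos fun h => by
    obtain ⟨s, h1, h2⟩ := (h.and hT').exists
    exact h1 h2
  have hF (F : Finset ι) {ε : ℝ} (hε : 0 < ε) :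
      0 < ν (T' ∩ {s | ∀ i ∈ F, r i s < ε}) := by
    classical
    induction F using Finset.induction_on with
    | empty => simpa using hT'pos
    | insert j F _ ih =>
      have hj : 0 < ν (T' ∩ {s | r j s < ε}) := hpos fun h => hinf j ε hε <| by
        filter_upwards [h, hT'] with s hs hsT
        exact not_lt.1 fun hlt => hs ⟨hsT, hlt⟩
      -- The common order makes the two sublevel sets nested, so their intersection is the smaller
      -- one, and both have positive measure.
      by_cases hsub : T' ∩ {s | r j s < ε} ⊆ {s | ∀ i ∈ F, r i s < ε}
      · refine hj.trans_le (measure_mono fun s hs => ⟨hs.1, fun i hi => ?_⟩)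
        obtain rfl | hi := Finset.mem_insert.1 hi
        exacts [hs.2, hsub hs i hi]
      · refine ih.trans_le (measure_mono fun s hs => ⟨hs.1, fun i hi => ?_⟩)
        obtain rfl | hi := Finset.mem_insert.1 hi
        · obtain ⟨s', hs', hs'F⟩ := Set.not_subset.1 hsub
          simp only [Set.mem_ofPred_eq, not_forall, not_lt] at hs'F
          obtain ⟨k, hk, hks⟩ := hs'F
          obtain h | h := hmono s (hT'T hs.1) s' (hT'T hs'.1)
          · exact (h i).trans_lt hs'.2
          · exact absurd (hks.trans (h k)) (not_le.2 (hs.2 k hk))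
        · exact hs.2 i hi
  obtain hι | hι := isEmpty_or_nonempty ι
  · exact ⟨1, one_pos, fun _ => T', fun _ => ⟨hT'm, hT'pos⟩, fun _ _ i => hι.elim i⟩
  obtain ⟨e, he⟩ := exists_surjective_nat ι
  obtain ⟨s₀, hs₀⟩ := nonempty_of_measure_ne_zero hT'pos.ne'
  obtain ⟨C, hC⟩ := hrb s₀
  -- The cap `r (e 0) s₀` yields the uniform bound: a point with `r (e 0)` below its value at `s₀`
  -- lies below `s₀` in the common order, so every `r i` is at most `r i s₀ ≤ C` there. The index `e
  -- 0` is constrained in every set.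
  set ε : ℕ → ℝ := fun n => min (1 / ((n : ℝ) + 1)) (r (e 0) s₀) with hε
  have hε0 (n : ℕ) : 0 < ε n := lt_min (by positivity) (hr0 _ _)
  classical
  refine ⟨C + 1, by linarith [hr0 (e 0) s₀, hC (e 0)], fun n => T' ∩
    {s | ∀ i ∈ (Finset.range (n + 1)).image e, r i s < ε n}, fun n => ⟨?_, hF _ (hε0 n)⟩, ?_⟩
  · refine hT'm.inter ?_
    simp only [Set.ofPred_forall]
    exact .iInter fun i => .iInter fun _ => measurableSet_lt (hrm i) measurable_const
  intro s hs i
  have hsk {k n : ℕ} (hkn : k ≤ n) : r (e k) (s n) < ε n :=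
    (hs n).2 _ (Finset.mem_image_of_mem e (Finset.mem_range.2 (by omega)))
  constructor
  · obtain ⟨k, rfl⟩ := he i
    refine squeeze_zero' (.of_forall fun n => (hr0 _ _).le) ?_
      tendsto_one_div_add_atTop_nhds_zero_nat
    filter_upwards [eventually_ge_atTop k] with n hn
    exact ((hsk hn).trans_le (min_le_left _ _)).le
  · intro n
    obtain h | h := hmono (s n) (hT'T (hs n).1) s₀ (hT'T hs₀)
    · linarith [h i, hC i]
    · exact absurd ((hsk n.zero_le).trans_le (min_le_right _ _)) (not_lt.2 (h (e 0)))

lemma refMeasure_ne_zero (I : SignalStructure Ω S) (x : Ω) : refMeasure S ≠ 0 := fun h => by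
  simpa [h] using I.lintegral_eq_one x

/-- Under the monotone likelihood ratio property, directionally unbounded beliefs fail only if the
likelihood ratio of some pair of states is bounded away from zero. -/
lemma exists_bounded_ratio_of_not_DUB {I : SignalStructure Ω S} (hMLRP : I.MLRP)
    (hDUB : ¬ I.DUB) :
    ∃ x₀ x₁ : Ω, x₀ ≠ x₁ ∧ ∃ c > 0, ∀ᵐ s ∂(refMeasure S), c * I.f s x₁ ≤ I.f s x₀ := by
  by_contra H
  obtain ⟨T, hT, hmono⟩ := hMLRP
  refine hDUB fun x => ?_
  have hm (y : Ω) : Measurable fun s => I.f s y / I.f s x :=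
    (I.measurable_f y).div (I.measurable_f x)
  have hp (y : Ω) (s : S) : 0 < I.f s y / I.f s x := div_pos (I.pos s y) (I.pos s x)
  have hb (s : S) : ∃ C, ∀ y, I.f s y / I.f s x ≤ C := by
    obtain ⟨C, hC⟩ := I.bounded s
    exact ⟨C / I.f s x, fun y => div_le_div_of_nonneg_right (hC ⟨y, rfl⟩) (I.pos s x).le⟩
  have hinf (y : Ω) (hy : y ≠ x) (c : ℝ) (hc : c > 0) :
      ¬ ∀ᵐ s ∂(refMeasure S), c ≤ I.f s y / I.f s x := fun h => H ⟨y, x, hy, c, hc, by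
    filter_upwards [h] with s hs
    exact (le_div_iff₀ (I.pos s x)).1 hs⟩
  -- Below `x` the ratios to `x` decrease in the signal, above `x` they increase; on each side any
  -- two signals are thus ordered alike by all ratios.
  have hup {y : Ω} (hy : y < x) {s s' : S} (hs : s ∈ T) (hs' : s' ∈ T) (hss : s < s') :
      I.f s' y / I.f s' x ≤ I.f s y / I.f s x := by
    have := inv_anti₀ (div_pos (I.pos s x) (I.pos s y)) (hmono y x hy s hs s' hs' hss)
    rwa [inv_div, inv_div] at this
  obtain ⟨C, hC, B, hB, hlim⟩ := exists_seq_tendsto_zero (refMeasure_ne_zero I x) hT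
    (r := fun (y : {y : Ω // y < x}) s => I.f s y / I.f s x) (fun y => hm y) (fun y => hp y)
    (fun s => (hb s).imp fun C hC y => hC y)
    (fun s hs s' hs' => by
      obtain h | rfl | h := lt_trichotomy s s'
      · exact .inr fun y => hup y.2 hs hs' h
      · exact .inl fun y => le_rfl
      · exact .inl fun y => hup y.2 hs' hs h)
    (fun y => hinf y y.2.ne)
  obtain ⟨C', hC', B', hB', hlim'⟩ := exists_seq_tendsto_zero (refMeasure_ne_zero I x) hT
    (r := fun (y : {y : Ω // x < y}) s => I.f s y / I.f s x) (fun y => hm y) (fun y => hp y)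
    (fun s => (hb s).imp fun C hC y => hC y)
    (fun s hs s' hs' => by
      obtain h | rfl | h := lt_trichotomy s s'
      · exact .inl fun y => hmono x y y.2 s hs s' hs' h
      · exact .inl fun y => le_rfl
      · exact .inr fun y => hmono x y y.2 s' hs' s hs h)
    (fun y => hinf y y.2.ne')
  refine ⟨max C C', lt_max_of_lt_left hC, B, B', hB, hB', fun s hs y hy => ?_, fun s hs y hy => ?_⟩
  · exact (hlim s hs ⟨y, hy⟩).imp_right fun h n => (h n).trans_le (le_max_left _ _)
  · exact (hlim' s hs ⟨y, hy⟩).imp_right fun h n => (h n).trans_le (le_max_right _ _)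

/-! ### A binary utility -/

variable {𝒜 : Type*}

open Classical in
/-- The action `b` is right from the state `x` on, and every other action is right before. -/
def thresholdUtility (b : 𝒜) (x : Ω) (c : 𝒜) (y : Ω) : ℝ :=
  if c = b then 0 else if y < x then 1 else -1

/-- All actions other than `b` are copies of one another, so a utility difference is zero or a
single step between `1` and `-1` at `x`. -/
lemma scd_thresholdUtility (b : 𝒜) (x : Ω) : SCD (thresholdUtility b x) := by
  intro c c'
  by_cases hc : c = b <;> by_cases hc' : c' = b
  · exact .inl fun y y' _ h => by simp [thresholdUtility, hc, hc']
  · refine .inl fun y y' hy h => ?_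
    simp only [thresholdUtility, hc, hc', if_true, if_false] at h ⊢
    split_ifs at h ⊢ with h1 h2 <;> first | linarith | exact absurd (hy.trans h1) h2
  · refine .inr fun y y' hy h => ?_
    simp only [thresholdUtility, hc, hc', if_true, if_false] at h ⊢
    split_ifs at h ⊢ with h1 h2 <;> first | linarith | exact absurd (hy.trans h1) h2
  · exact .inl fun y y' _ h => by simp [thresholdUtility, hc, hc']

lemma admissible_thresholdUtility (b : 𝒜) (x : Ω) : Admissible (thresholdUtility b x) where
  bounded c := ⟨1, fun y => by unfold thresholdUtility; split_ifs <;> simp⟩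
  choice_nonempty A _ hA μ := by
    -- Expected utility takes at most two values over all actions, so a maximum exists even in an
    -- infinite choice set.
    have hfin : (Set.image (expectedUtility (thresholdUtility b x) μ) A).Finite := by
      refine Set.Finite.subset (Set.toFinite {∑' y, (μ y).toReal * 0,
        ∑' y, (μ y).toReal * (if y < x then 1 else -1)}) ?_
      rintro _ ⟨c, -, rfl⟩
      by_cases hc : c = b
      · exact .inl (by simp [expectedUtility, thresholdUtility, hc])
      · exact .inr (by simp [expectedUtility, thresholdUtility, hc])
    obtain ⟨_, ⟨c, hcA, rfl⟩, hmax⟩ := hfin.exists_maximal (hA.nonempty.image _)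
    refine ⟨c, hcA, fun c' hc' => ?_⟩
    by_contra! hlt
    exact hlt.not_ge (hmax ⟨c', hc', rfl⟩ hlt.le)

end

end SequentialLearning

end

/-! ### The two actions and the critical state -/

theorem proposition3 {Ω : Set ℤ} {S : Set ℝ} (hS : S.Countable ∨ S.OrdConnected)
    {𝒜 : Type*} [Nontrivial 𝒜] [MeasurableSpace 𝒜] [DiscreteMeasurableSpace 𝒜]
    (I : SequentialLearning.SignalStructure Ω S) (hMLRP : I.MLRP) (hDUB : ¬ I.DUB) :
    ∃ u : 𝒜 → Ω → ℝ, SequentialLearning.Admissible u ∧ SequentialLearning.SCD u ∧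
      ∃ (a b : 𝒜) (ωstar : Ω), a ≠ b ∧
        (∀ ω, ω < ωstar → u b ω < u a ω) ∧ (∀ ω, ωstar ≤ ω → u a ω < u b ω) ∧
        ∀ μ₀ : PMF Ω, (∀ ω, 0 < μ₀ ω) →
          SequentialLearning.InadequateLearning u I μ₀ ({a, b} : Set 𝒜) := by
  obtain ⟨x₀, x₁, hne, c, hc, hI⟩ :=
    SequentialLearning.exists_bounded_ratio_of_not_DUB hMLRP hDUB
  obtain ⟨a, b, hab⟩ := exists_pair_ne 𝒜
  refine ⟨SequentialLearning.thresholdUtility b (max x₀ x₁),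
    SequentialLearning.admissible_thresholdUtility _ _,
    SequentialLearning.scd_thresholdUtility _ _, a, b, max x₀ x₁, hab, fun ω hω => ?_,
    fun ω hω => ?_, fun μ₀ hμ₀ => ?_⟩
  · simp [SequentialLearning.thresholdUtility, hab, hω]
  · simp [SequentialLearning.thresholdUtility, hab, not_lt.2 hω]
  have ha : a ∈ ({a, b} : Set 𝒜) := .inl rfl
  have hb : b ∈ ({a, b} : Set 𝒜) := .inr rfl
  have hA (d : ({a, b} : Set 𝒜)) : d = ⟨a, ha⟩ ∨ d = ⟨b, hb⟩ :=
    d.2.imp (fun h => Subtype.ext h) fun h => Subtype.ext h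
  -- The bound is not symmetric in `x₀` and `x₁`, so `α` must be the action that is right at `x₀`:
  -- `a` if `x₀` is the smaller state, `b` otherwise.
  obtain hlt | hlt := lt_or_gt_of_ne hne
  · rw [max_eq_right hlt.le]
    refine SequentialLearning.inadequateLearning_of_bounded_ratio (α := ⟨a, ha⟩) (β := ⟨b, hb⟩)
      hA (L := {ω | ω < x₁}) (fun ω hω => ?_) (fun ω hω => ?_) ?_ hlt (lt_irrefl x₁) hc hI hμ₀
    · simp [SequentialLearning.thresholdUtility, hab, show ω < x₁ from hω]
    · simp [SequentialLearning.thresholdUtility, hab, show ¬ ω < x₁ from hω]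
    · exact (SequentialLearning.admissible_thresholdUtility b x₁).bounded b
  · rw [max_eq_left hlt.le]
    refine SequentialLearning.inadequateLearning_of_bounded_ratio (α := ⟨b, hb⟩) (β := ⟨a, ha⟩)
      (fun d => (hA d).symm) (L := {ω | ¬ ω < x₀}) (fun ω hω => ?_) (fun ω hω => ?_) ?_
      (lt_irrefl x₀) (not_not.2 hlt) hc hI hμ₀
    · simp [SequentialLearning.thresholdUtility, hab, show ¬ ω < x₀ from hω]
    · simp [SequentialLearning.thresholdUtility, hab, show ω < x₀ from not_not.1 hω]
    · exact (SequentialLearning.admissible_thresholdUtility b x₀).bounded a
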